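/- Let $F$ be a closed surface (a compact Hausdorff 2-manifold without boundary, possibly non-orientable) and let $D_F$ be an oriented link diagram in $F$, i.e. finitely many oriented closed curves in $F$, simple and disjoint except for finitely many transverse double points, called crossings, which carry over/under information. (For instance, $(F,D_F)$ may be a link diagram realization of a twisted link diagram $D$: the image of the abstract link diagram associated with $D$ under an embedding of its surface into $F$.) Apply an A-splice or a B-splice at each crossing of $D_F$. A splice that is compatible with the orientations creates no poles. A splice that is not compatible with them creates two poles: a sink pole on the arc joining the two incoming ends and a source pole on the arc joining the two outgoing ends, each pole lying on the side of its arc that faces the region between the two arcs. The result is a collection $s$ of mutually disjoint simple closed curves with poles (pole curves) in $F$; $(F,s)$ is called a surface pole state of $(F,D_F)$. A pole reduction removes from a pole curve a sink pole and a source pole that are adjacent along an arc of the curve and lie on the same side of this arc. The index $\iota(l)$ of a pole curve $l$ is half the number of poles of an irreducible pole curve (one to which no pole reduction applies) obtained from $l$ by pole reductions. Let $l$ be a pole curve of a surface pole state $(F,s)$ of $(F,D_F)$. If $\iota(l)>0$, then $l$ is not a separating curve in $F$; that is, the complement of $l$ in the connected component of $F$ containing $l$ (in $F$ itself if $F$ is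 connected) is connected. -/

import Mathlib

open Set Filter Topology

namespace TwistedLink

/-! ### Curves in a surface and their local sides -/

section Sides

variable {F : Type*} [TopologicalSpace F]

/-- `e` is a chart of the surface around `x`, modelled on the whole plane, in which the set `L` is
the horizontal axis. -/
def IsFlatChart (L : Set F) (x : F) (e : ℝ × ℝ → F) : Prop :=
  IsOpenEmbedding e ∧ e (0, 0) = x ∧ e ⁻¹' L = {p | p.2 = 0}

/-- Near the point `x` of the curve `L`, the set `W` is exactly one of the two local sides
of `L`. -/
def IsSideAt (L W : Set F) (x : F) : Prop :=
  ∃ e : ℝ × ℝ → F, IsFlatChart L x e ∧ e ⁻¹' W = {p | 0 < p.2}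

/-- A closed curve `L` is non-separating: removing it from the connected component of the surface
that contains it leaves a connected set. (If `F` is connected this says that `F \ L` is
connected.) -/
def IsNonSeparating (L : Set F) : Prop :=
  ∀ x ∈ L, IsConnected (connectedComponent x \ L)

/-- Just after time `t`, the curve `α` runs along the curve `β` followed forwards from
time `u`. -/
def SameDirection (α β : UnitAddCircle → F) (t u : UnitAddCircle) : Prop :=
  Tendsto (fun ε : ℝ => α (t + (ε : UnitAddCircle))) (𝓝[>] 0)
    (map (fun δ : ℝ => β (u + (δ : UnitAddCircle))) (𝓝[>] 0))

/-- Just after time `t`, the curve `α` runs along the curve `β` followed backwards from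
time `u`. -/
def OppositeDirection (α β : UnitAddCircle → F) (t u : UnitAddCircle) : Prop :=
  Tendsto (fun ε : ℝ => α (t + (ε : UnitAddCircle))) (𝓝[>] 0)
    (map (fun δ : ℝ => β (u - (δ : UnitAddCircle))) (𝓝[>] 0))

end Sides

/-! ### Pole curves, pole reductions, index -/

/-- Sink poles (I-poles) and source poles (O-poles). -/
inductive PoleKind where
  | sink
  | source

/-- A pole curve: a simple closed curve with finitely many poles on it. Every pole lies on one of
the two local sides of the curve. The arcs between the poles are oriented, both towards a sink
pole and both away from a source pole. -/
structure PoleCurve (F : Type*) [TopologicalSpace F] where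
  /-- a parametrization of the curve -/
  toFun : UnitAddCircle → F
  continuous_toFun : Continuous toFun
  injective_toFun : Function.Injective toFun
  /-- the parameters of the poles -/
  poles : Finset UnitAddCircle
  /-- the kinds of the poles (irrelevant at other parameters) -/
  kind : UnitAddCircle → PoleKind
  /-- a set which near the pole is the side on which the pole lies (irrelevant at other
  parameters, and relevant at a pole only up to equality near the pole) -/
  side : UnitAddCircle → Set F
  isSideAt_side : ∀ t ∈ poles, IsSideAt (range toFun) (side t) (toFun t)
  /-- the orientation off the poles: `true` if it is the one given by the parametrization -/
  dir : UnitAddCircle → Bool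
  dir_of_notMem : ∀ t, t ∉ poles → ∀ᶠ ε : ℝ in 𝓝 0, dir (t + (ε : UnitAddCircle)) = dir t
  dir_of_sink : ∀ t ∈ poles, kind t = PoleKind.sink → ∀ᶠ ε : ℝ in 𝓝[>] 0,
    dir (t - (ε : UnitAddCircle)) = true ∧ dir (t + (ε : UnitAddCircle)) = false
  dir_of_source : ∀ t ∈ poles, kind t = PoleKind.source → ∀ᶠ ε : ℝ in 𝓝[>] 0,
    dir (t - (ε : UnitAddCircle)) = false ∧ dir (t + (ε : UnitAddCircle)) = true

namespace PoleCurve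

variable {F : Type*} [TopologicalSpace F]

/-- The underlying simple closed curve. -/
def carrier (l : PoleCurve F) : Set F := range l.toFun

/-- The poles at `p` and `q` can be removed by a pole reduction: one is a sink and the other a
source, one of the two arcs of the curve between them (the one from `p` forwards to `q`) contains
no other pole, and both poles lie on the same side of this arc. -/
def IsReduciblePair (l : PoleCurve F) (p q : UnitAddCircle) : Prop :=
  p ∈ l.poles ∧ q ∈ l.poles ∧ l.kind p ≠ l.kind q ∧
    ∃ d : ℝ, 0 < d ∧ d < 1 ∧ q = p + (d : UnitAddCircle) ∧
      (∀ r : ℝ, 0 < r → r < d → p + (r : UnitAddCircle) ∉ l.poles) ∧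
      ∃ W : Set F,
        (∀ r : ℝ, 0 ≤ r → r ≤ d → IsSideAt l.carrier W (l.toFun (p + (r : UnitAddCircle)))) ∧
        (∀ᶠ y in 𝓝 (l.toFun p), y ∈ W ↔ y ∈ l.side p) ∧
        (∀ᶠ y in 𝓝 (l.toFun q), y ∈ W ↔ y ∈ l.side q)

/-- `l'` is obtained from `l` by one pole reduction. The orientation of `l'` is forced by its
poles, and arbitrary when no pole is left. -/
def Reduces (l l' : PoleCurve F) : Prop :=
  ∃ p q, l.IsReduciblePair p q ∧ l'.toFun = l.toFun ∧
    (∀ t, t ∈ l'.poles ↔ t ∈ l.poles ∧ t ≠ p ∧ t ≠ q) ∧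
    ∀ t ∈ l'.poles, l'.kind t = l.kind t ∧
      ∀ᶠ y in 𝓝 (l.toFun t), y ∈ l'.side t ↔ y ∈ l.side t

/-- No pole reduction can be applied. -/
def IsIrreducible (l : PoleCurve F) : Prop := ∀ p q, ¬ l.IsReduciblePair p q

/-- `ι(l) = k`: pole reductions lead from `l` to an irreducible pole curve with `2 k` poles. -/
def HasIndex (l : PoleCurve F) (k : ℕ) : Prop :=
  ∃ l' : PoleCurve F, Relation.ReflTransGen Reduces l l' ∧ l'.IsIrreducible ∧
    l'.poles.card = 2 * k

end PoleCurve

/-- A pole curve link: a finite collection of mutually disjoint pole curves. -/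
structure PoleCurveLink (F : Type*) [TopologicalSpace F] where
  /-- the number of pole curves -/
  n : ℕ
  curve : Fin n → PoleCurve F
  disjoint : ∀ i j, i ≠ j → Disjoint (curve i).carrier (curve j).carrier

/-- The union of the curves of a pole curve link. -/
def PoleCurveLink.carrier {F : Type*} [TopologicalSpace F] (s : PoleCurveLink F) : Set F :=
  ⋃ i, (s.curve i).carrier

/-! ### Link diagrams in a surface -/

/-- An (oriented) link diagram in a surface `F`: finitely many closed curves whose only
singularities are finitely many transverse double points, with over/under information there. -/
structure LinkDiagram (F : Type*) [TopologicalSpace F] where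
  /-- the number of components -/
  n : ℕ
  /-- the components, oriented by their parametrizations -/
  comp : Fin n → UnitAddCircle → F
  continuous_comp : ∀ k, Continuous (comp k)
  /-- the number of crossings -/
  m : ℕ
  /-- a neighbourhood of each crossing, identified with the plane, the crossing being the
  origin -/
  chart : Fin m → ℝ × ℝ → F
  isOpenEmbedding_chart : ∀ c, IsOpenEmbedding (chart c)
  disjoint_chart : ∀ c c', c ≠ c' → Disjoint (range (chart c)) (range (chart c'))
  /-- near a crossing the diagram consists of the two axes -/
  chart_preimage : ∀ c, chart c ⁻¹' (⋃ k, range (comp k)) = {p | p.1 = 0 ∨ p.2 = 0}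
  /-- the component and the time at which the horizontal axis is run through the crossing -/
  strandX : Fin m → Fin n × UnitAddCircle
  /-- the component and the time at which the vertical axis is run through the crossing -/
  strandY : Fin m → Fin n × UnitAddCircle
  /-- the two strands are the only ones through the crossing -/
  comp_eq_crossing : ∀ c k t, comp k t = chart c (0, 0) ↔ (k, t) = strandX c ∨ (k, t) = strandY c
  /-- both axes are run through in the positive direction -/
  strandX_out : ∀ c, Tendsto
    (fun ε : ℝ => comp (strandX c).1 ((strandX c).2 + (ε : UnitAddCircle))) (𝓝[>] 0)
    (map (fun r : ℝ => chart c (r, 0)) (𝓝[>] 0))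
  strandX_in : ∀ c, Tendsto
    (fun ε : ℝ => comp (strandX c).1 ((strandX c).2 - (ε : UnitAddCircle))) (𝓝[>] 0)
    (map (fun r : ℝ => chart c (-r, 0)) (𝓝[>] 0))
  strandY_out : ∀ c, Tendsto
    (fun ε : ℝ => comp (strandY c).1 ((strandY c).2 + (ε : UnitAddCircle))) (𝓝[>] 0)
    (map (fun r : ℝ => chart c (0, r)) (𝓝[>] 0))
  strandY_in : ∀ c, Tendsto
    (fun ε : ℝ => comp (strandY c).1 ((strandY c).2 - (ε : UnitAddCircle))) (𝓝[>] 0)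
    (map (fun r : ℝ => chart c (0, -r)) (𝓝[>] 0))
  /-- the horizontal strand is the over-strand (with respect to the local orientation of `F`
  for which `chart c` is positive; reversing both the local orientation and the roles of over
  and under describes the same crossing) -/
  xOver : Fin m → Bool
  /-- away from the crossings the curves are simple and disjoint ... -/
  simple : ∀ k t, (∀ c, comp k t ≠ chart c (0, 0)) →
    ∀ k' t', comp k' t' = comp k t → k' = k ∧ t' = t
  /-- ... and locally flat -/
  flat : ∀ k t, (∀ c, comp k t ≠ chart c (0, 0)) →
    ∃ e, IsFlatChart (⋃ k, range (comp k)) (comp k t) e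

/-! ### Splices and surface pole states -/

/-- The two kinds of splices. -/
inductive Splice where
  | A
  | B

/-- The two arcs replacing the axes in a splice that respects the orientations of the axes.
Outside the square `|x + y| ≤ 1`, `|x - y| ≤ 1` they coincide with the axes; they join the
negative horizontal half-axis to the positive vertical one, and the negative vertical half-axis
to the positive horizontal one. -/
def orientedArcs : Set (ℝ × ℝ) := {p | |p.1 - p.2| = max |p.1 + p.2| 1}

/-- The two arcs replacing the axes in a splice that does not respect the orientations of the
axes: they join the two negative half-axes, and the two positive ones. -/
def unorientedArcs : Set (ℝ × ℝ) := {p | |p.1 + p.2| = max |p.1 - p.2| 1}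

/-- The region between the two arcs of a splice that does not respect the orientations. Both
poles arising from the splice lie in it. -/
def middleRegion : Set (ℝ × ℝ) := {p | |p.1 + p.2| < max |p.1 - p.2| 1}

/-- The square inside which a splice changes the diagram. -/
def spliceSquare : Set (ℝ × ℝ) := {p | |p.1 + p.2| ≤ 1 ∧ |p.1 - p.2| ≤ 1}

namespace LinkDiagram

variable {F : Type*} [TopologicalSpace F]

/-- The union of the curves of the diagram. -/
def carrier (D : LinkDiagram F) : Set F := ⋃ k, range (D.comp k)

/-- Whether the splice of the given kind at the crossing `c` respects the orientations. An
A-splice joins the two regions swept out by the over-strand when it is turned counterclockwise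
onto the under-strand, a B-splice joins the two others. -/
def IsOrientedSplice (D : LinkDiagram F) (c : Fin D.m) : Splice → Prop
  | Splice.A => D.xOver c = true
  | Splice.B => D.xOver c = false

open Classical in
/-- The arcs by which a splice replaces the crossing, in the chart at the crossing. -/
noncomputable def spliceArcs (D : LinkDiagram F) (c : Fin D.m) (a : Splice) : Set (ℝ × ℝ) :=
  if D.IsOrientedSplice c a then orientedArcs else unorientedArcs

/-- The union of closed curves obtained from the diagram by splicing every crossing. -/
noncomputable def splicedCarrier (D : LinkDiagram F) (σ : Fin D.m → Splice) : Set F :=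
  (D.carrier \ ⋃ c, range (D.chart c)) ∪ ⋃ c, D.chart c '' D.spliceArcs c (σ c)

/-- The sink pole lies on the arc joining the two incoming half-axes. -/
noncomputable def sinkPoint (D : LinkDiagram F) (c : Fin D.m) : F := D.chart c (-(1 / 2), -(1 / 2))

/-- The source pole lies on the arc joining the two outgoing half-axes. -/
noncomputable def sourcePoint (D : LinkDiagram F) (c : Fin D.m) : F := D.chart c (1 / 2, 1 / 2)

/-- The pole curve link `s` is the result of applying the splices `σ` at the crossings of `D`:
its curves are those of the spliced diagram; its poles are a sink pole and a source pole for each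
splice that does not respect the orientations, both on the side of the region between the two
arcs; and away from the splices its orientation is that of `D`. -/
structure IsSpliceOf (D : LinkDiagram F) (σ : Fin D.m → Splice) (s : PoleCurveLink F) : Prop where
  carrier_eq : s.carrier = D.splicedCarrier σ
  mem_poles : ∀ i t, t ∈ (s.curve i).poles ↔ ∃ c, ¬ D.IsOrientedSplice c (σ c) ∧
    ((s.curve i).toFun t = D.sinkPoint c ∨ (s.curve i).toFun t = D.sourcePoint c)
  sink : ∀ i, ∀ t ∈ (s.curve i).poles, ∀ c, (s.curve i).toFun t = D.sinkPoint c →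
    (s.curve i).kind t = PoleKind.sink
  source : ∀ i, ∀ t ∈ (s.curve i).poles, ∀ c, (s.curve i).toFun t = D.sourcePoint c →
    (s.curve i).kind t = PoleKind.source
  side : ∀ i, ∀ t ∈ (s.curve i).poles, ∀ c,
    ((s.curve i).toFun t = D.sinkPoint c ∨ (s.curve i).toFun t = D.sourcePoint c) →
    ∀ᶠ y in 𝓝 ((s.curve i).toFun t), y ∈ (s.curve i).side t ↔ y ∈ D.chart c '' middleRegion
  dir : ∀ i t, (∀ c, (s.curve i).toFun t ∉ D.chart c '' spliceSquare) →
    ∀ k u, D.comp k u = (s.curve i).toFun t →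
      ((s.curve i).dir t = true → SameDirection (s.curve i).toFun (D.comp k) t u) ∧
      ((s.curve i).dir t = false → OppositeDirection (s.curve i).toFun (D.comp k) t u)

/-- `s` is a surface pole state of `D`: it results from an A-splice or a B-splice at each
crossing. -/
def IsSurfacePoleState (D : LinkDiagram F) (s : PoleCurveLink F) : Prop :=
  ∃ σ : Fin D.m → Splice, D.IsSpliceOf σ s

end LinkDiagram

end TwistedLink

/-!
Suppose that a pole curve `l` of the state separates, with sides `U` and `V`. A splice that does
not respect the orientations creates a sink and a source, both facing the region between its two
arcs, and this region is connected and misses `l`, so it lies in `U` or in `V`. Hence, over all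
curves of the state, as many sinks as sources face `U`. On every pole curve sinks and sources
alternate, so a curve other than `l`, which lies in `U` or in `V` together with the regions at its
poles, contributes as many sinks as sources facing `U`; therefore so does `l`. Pole reductions
preserve the number of sinks minus the number of sources facing `U`. On an irreducible curve
consecutive poles differ both in kind and in side, so that all poles facing `U` are of one kind and
all poles facing `V` of the other: the balance then leaves no pole at all, and `ι(l) = 0`.
-/

namespace TwistedLink

section Flat

variable {F G : Type*} [TopologicalSpace F] [TopologicalSpace G]

/-- Every point of `S` has a chart in which `S` is the horizontal axis, so that `S` is a locally
flat 1-dimensional submanifold of a surface. -/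
def IsLocallyFlat (S : Set F) : Prop := ∀ x ∈ S, ∃ e, IsFlatChart S x e

namespace IsFlatChart

variable {S T : Set F} {x : F} {e : ℝ × ℝ → F}

theorem apply_mem_iff (he : IsFlatChart S x e) {p : ℝ × ℝ} : e p ∈ S ↔ p.2 = 0 :=
  Set.ext_iff.1 he.2.2 p

theorem mem (he : IsFlatChart S x e) : x ∈ S :=
  he.2.1 ▸ he.apply_mem_iff.2 rfl

theorem range_mem_nhds (he : IsFlatChart S x e) : range e ∈ 𝓝 x :=
  he.1.isOpen_range.mem_nhds ⟨_, he.2.1⟩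

theorem exists_apply_mem_of_mem_closure (he : IsFlatChart S x e) (hx : x ∈ closure T) :
    ∃ p, e p ∈ T := by
  obtain ⟨_, ⟨p, rfl⟩, hp⟩ := mem_closure_iff_nhds.1 hx _ he.range_mem_nhds
  exact ⟨p, hp⟩

theorem comp_isOpenEmbedding (he : IsFlatChart S x e) {g : F → G} (hg : IsOpenEmbedding g)
    {T : Set G} (hT : g ⁻¹' T = S) : IsFlatChart T (g x) (g ∘ e) :=
  ⟨hg.comp he.1, by simp [he.2.1], by rw [preimage_comp, hT, he.2.2]⟩

theorem comp_reflection (he : IsFlatChart S x e) : IsFlatChart S x (e ∘ Prod.map id Neg.neg) :=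
  ⟨he.1.comp (IsOpenEmbedding.id.prodMap (Homeomorph.neg ℝ).isOpenEmbedding), by simp [he.2.1], by
    rw [preimage_comp, he.2.2]
    ext p
    simp⟩

theorem exists_of_eventuallyEq (he : IsFlatChart S x e) (hST : S =ᶠ[𝓝 x] T) :
    ∃ e', IsFlatChart T x e' := by
  obtain ⟨δ, hδ, hball⟩ := Metric.eventually_nhds_iff_ball.1
    (he.1.continuous.continuousAt.eventually (he.2.1 ▸ hST.mem_iff))
  -- Precompose with an embedding of the plane onto the `δ`-square preserving the axis.
  set φ := OpenPartialHomeomorph.univBall (0 : ℝ) δ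
  have hφ : IsOpenEmbedding φ :=
    φ.isOpenEmbedding (OpenPartialHomeomorph.univBall_source _ _)
  have hφ_zero : φ 0 = 0 := OpenPartialHomeomorph.univBall_apply_zero _ _
  have hφ_mem (t : ℝ) : φ t ∈ Metric.ball (0 : ℝ) δ := by
    rw [← OpenPartialHomeomorph.univBall_target (0 : ℝ) hδ]
    exact φ.map_source (by simp [φ])
  refine ⟨e ∘ Prod.map φ φ, he.1.comp (hφ.prodMap hφ), by simp [hφ_zero, he.2.1], ?_⟩
  ext ⟨u, v⟩
  have hmem : (φ u, φ v) ∈ Metric.ball ((0, 0) : ℝ × ℝ) δ := by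
    rw [← ball_prod_same]
    exact ⟨hφ_mem u, hφ_mem v⟩
  calc e (φ u, φ v) ∈ T ↔ e (φ u, φ v) ∈ S := (hball _ hmem).symm
    _ ↔ φ v = φ 0 := by rw [he.apply_mem_iff, hφ_zero]
    _ ↔ v = 0 := hφ.injective.eq_iff

theorem isPreconnected_image_upper (he : IsFlatChart S x e) :
    IsPreconnected (e '' {p | 0 < p.2}) :=
  (convex_halfSpace_gt (LinearMap.snd ℝ ℝ ℝ).isLinear 0).isPreconnected.image _
    he.1.continuous.continuousOn

theorem disjoint_image_upper (he : IsFlatChart S x e) : Disjoint (e '' {p | 0 < p.2}) S := by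
  rw [Set.disjoint_left]
  rintro _ ⟨p, hp, rfl⟩ hpS
  exact (ne_of_gt hp) (he.apply_mem_iff.1 hpS)

theorem exists_isPreconnected_of_notMem (he : IsFlatChart S x e) {p : ℝ × ℝ} (hp : e p ∉ S) :
    ∃ A, IsPreconnected A ∧ e p ∈ A ∧ Disjoint A S ∧ range e ∩ S ⊆ closure A := by
  -- `A` is the half of the chart, cut along `S`, that contains `e p`.
  obtain ⟨I, hI, hpI, hI_zero, hI_closure⟩ :
      ∃ I : Set ℝ, IsPreconnected I ∧ p.2 ∈ I ∧ (0 : ℝ) ∉ I ∧ (0 : ℝ) ∈ closure I := by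
    rcases lt_or_gt_of_ne (mt he.apply_mem_iff.2 hp) with h | h
    · exact ⟨Iio 0, isPreconnected_Iio, h, self_notMem_Iio, by simp⟩
    · exact ⟨Ioi 0, isPreconnected_Ioi, h, self_notMem_Ioi, by simp⟩
  refine ⟨e '' (univ ×ˢ I), ?_, mem_image_of_mem e ⟨mem_univ _, hpI⟩, ?_, ?_⟩
  · exact (isPreconnected_univ.prod hI).image _ he.1.continuous.continuousOn
  · rw [Set.disjoint_left]
    rintro _ ⟨q, hq, rfl⟩ hqS
    exact hI_zero (he.apply_mem_iff.1 hqS ▸ hq.2)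
  · rintro _ ⟨⟨q, rfl⟩, hqS⟩
    refine image_closure_subset_closure_image he.1.continuous (mem_image_of_mem e ?_)
    rw [closure_prod_eq]
    exact ⟨by simp, he.apply_mem_iff.1 hqS ▸ hI_closure⟩

end IsFlatChart

theorem IsLocallyFlat.preimage_homeomorph {T : Set G} (hT : IsLocallyFlat T) (g : F ≃ₜ G) :
    IsLocallyFlat (g ⁻¹' T) := by
  intro x hx
  obtain ⟨e, he⟩ := hT (g x) hx
  refine ⟨g.symm ∘ e, ?_⟩
  rw [← g.symm_apply_apply x]
  exact he.comp_isOpenEmbedding g.symm.isOpenEmbedding (by ext; simp)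

end Flat

section Sides

variable {F : Type*} [TopologicalSpace F]

/-- `U` and `V` partition the complement of `L`, and no connected subset of the complement meets
both of them. They are not required to be open, so that a separation of the component containing
`L` extends to all of `F` even if `F` is not locally connected. -/
structure IsSplitting (L U V : Set F) : Prop where
  disjoint : Disjoint U V
  union_eq : U ∪ V = Lᶜ
  subset_or_subset : ∀ A, IsPreconnected A → Disjoint A L → A ⊆ U ∨ A ⊆ V

/-- `U` and `V` are the two sides of a separating curve `L`: a splitting of the complement in which
both parts accumulate at every point of `L`. -/
structure IsSeparation (L U V : Set F) : Prop extends IsSplitting L U V where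
  subset_closure_left : L ⊆ closure U
  subset_closure_right : L ⊆ closure V

theorem IsSideAt.nhdsWithin_neBot {L W : Set F} {x : F} (hW : IsSideAt L W x) :
    (𝓝[W] x).NeBot := by
  obtain ⟨e, he, heW⟩ := hW
  have hzero : ((0, 0) : ℝ × ℝ) ∈ closure (univ ×ˢ Ioi (0 : ℝ)) := by simp [closure_prod_eq]
  have hsub : e '' (univ ×ˢ Ioi 0) ⊆ W :=
    image_subset_iff.2 fun p hp => heW.symm.subset hp.2
  rw [← mem_closure_iff_nhdsWithin_neBot, ← he.2.1]
  exact closure_mono hsub (image_closure_subset_closure_image he.1.continuous ⟨_, hzero, rfl⟩)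

namespace IsSplitting

variable {L U V W A : Set F} {x : F} {e : ℝ × ℝ → F}

protected theorem symm (h : IsSplitting L U V) : IsSplitting L V U :=
  ⟨h.disjoint.symm, union_comm V U ▸ h.union_eq, fun A hA hAL => (h.subset_or_subset A hA hAL).symm⟩

theorem notMem_of_mem_left (h : IsSplitting L U V) (hx : x ∈ U) : x ∉ L :=
  h.union_eq.subset (Or.inl hx)

theorem mem_or_mem (h : IsSplitting L U V) (hx : x ∉ L) : x ∈ U ∨ x ∈ V :=
  h.union_eq.symm.subset hx

theorem subset_left (h : IsSplitting L U V) (hA : IsPreconnected A) (hAL : Disjoint A L)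
    (hxA : x ∈ A) (hxU : x ∈ U) : A ⊆ U :=
  (h.subset_or_subset A hA hAL).resolve_right fun hAV =>
    Set.disjoint_left.1 h.disjoint hxU (hAV hxA)

theorem mem_nhdsWithin_or (h : IsSplitting L U V) (hW : IsSideAt L W x) :
    U ∈ 𝓝[W] x ∨ V ∈ 𝓝[W] x := by
  obtain ⟨e, he, heW⟩ := hW
  have hmem : e '' {p | 0 < p.2} ∈ 𝓝[W] x := by
    rw [← heW, image_preimage_eq_inter_range]
    exact inter_mem self_mem_nhdsWithin (mem_nhdsWithin_of_mem_nhds he.range_mem_nhds)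
  exact (h.subset_or_subset _ he.isPreconnected_image_upper he.disjoint_image_upper).imp
    (mem_of_superset hmem) (mem_of_superset hmem)

theorem notMem_nhdsWithin_of_mem (h : IsSplitting L U V) [(𝓝[W] x).NeBot] (hU : U ∈ 𝓝[W] x) :
    V ∉ 𝓝[W] x := fun hV =>
  empty_notMem (𝓝[W] x) (h.disjoint.inter_eq ▸ inter_mem hU hV)

theorem eventually_mem_closure (h : IsSplitting L U V) (hL : IsLocallyFlat L) (hx : x ∈ L)
    (hxU : x ∈ closure U) : ∀ᶠ y in 𝓝 x, y ∈ L → y ∈ closure U := by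
  obtain ⟨e, he⟩ := hL x hx
  obtain ⟨p, hp⟩ := he.exists_apply_mem_of_mem_closure hxU
  obtain ⟨A, hA, hpA, hAL, hcl⟩ := he.exists_isPreconnected_of_notMem (h.notMem_of_mem_left hp)
  filter_upwards [he.range_mem_nhds] with y hy hyL
  exact closure_mono (h.subset_left hA hAL hpA hp) (hcl ⟨hy, hyL⟩)

theorem subset_closure_left (h : IsSplitting L U V) (hL : IsLocallyFlat L) (hLc : IsPreconnected L)
    (hne : (L ∩ closure U).Nonempty) : L ⊆ closure U := by
  by_contra hnot
  obtain ⟨y, hyL, hy⟩ := not_subset.1 hnot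
  obtain ⟨x, hxL, hx⟩ := hne
  obtain ⟨z, hzL, hz, hz'⟩ := hLc {z | ∀ᶠ y in 𝓝 z, y ∈ L → y ∈ closure U} (closure U)ᶜ
    isOpen_setOfPred_eventually_nhds isClosed_closure.isOpen_compl
    (fun z hz => (em (z ∈ closure U)).imp_left (h.eventually_mem_closure hL hz))
    ⟨x, hxL, h.eventually_mem_closure hL hxL hx⟩ ⟨y, hyL, hy⟩
  exact hz' (hz.self_of_nhds hzL)

theorem apply_mem_left_of_pos (h : IsSplitting L U V) (he : IsFlatChart L x e) {p q : ℝ × ℝ}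
    (hp : 0 < p.2) (hpU : e p ∈ U) (hq : 0 < q.2) : e q ∈ U :=
  h.subset_left he.isPreconnected_image_upper he.disjoint_image_upper (mem_image_of_mem e hp) hpU
    (mem_image_of_mem e hq)

theorem apply_mem_left_of_neg (h : IsSplitting L U V) (he : IsFlatChart L x e) {p q : ℝ × ℝ}
    (hp : p.2 < 0) (hpU : e p ∈ U) (hq : q.2 < 0) : e q ∈ U := by
  have := h.apply_mem_left_of_pos he.comp_reflection (p := (p.1, -p.2)) (q := (q.1, -q.2))
  simp_all

end IsSplitting

namespace IsSeparation

variable {L U V W : Set F} {x : F} {e : ℝ × ℝ → F}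

protected theorem symm (h : IsSeparation L U V) : IsSeparation L V U :=
  ⟨h.toIsSplitting.symm, h.subset_closure_right, h.subset_closure_left⟩

theorem preimage_eq_of_apply_mem (h : IsSeparation L U V) (he : IsFlatChart L x e) {p : ℝ × ℝ}
    (hp : 0 < p.2) (hpU : e p ∈ U) : e ⁻¹' U = {q | 0 < q.2} ∧ e ⁻¹' V = {q | q.2 < 0} := by
  have hdisj {q : ℝ × ℝ} (hqU : e q ∈ U) (hqV : e q ∈ V) : False :=
    Set.disjoint_left.1 h.disjoint hqU hqV
  have hupper {q : ℝ × ℝ} (hq : 0 < q.2) : e q ∈ U := h.apply_mem_left_of_pos he hp hpU hq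
  obtain ⟨r, hrV⟩ := he.exists_apply_mem_of_mem_closure (h.subset_closure_right he.mem)
  have hr_ne : r.2 ≠ 0 := mt he.apply_mem_iff.2 (h.symm.notMem_of_mem_left hrV)
  have hr : r.2 < 0 := hr_ne.lt_of_le (not_lt.1 fun hr => hdisj (hupper hr) hrV)
  have hlower {q : ℝ × ℝ} (hq : q.2 < 0) : e q ∈ V := h.symm.apply_mem_left_of_neg he hr hrV hq
  refine ⟨ext fun q => ⟨fun hqU => ?_, hupper⟩, ext fun q => ⟨fun hqV => ?_, hlower⟩⟩
  · have hq_ne : q.2 ≠ 0 := mt he.apply_mem_iff.2 (h.notMem_of_mem_left hqU)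
    exact hq_ne.lt_or_gt.resolve_left fun hq => hdisj hqU (hlower hq)
  · have hq_ne : q.2 ≠ 0 := mt he.apply_mem_iff.2 (h.symm.notMem_of_mem_left hqV)
    exact hq_ne.lt_or_gt.resolve_right fun hq => hdisj (hupper hq) hqV

theorem isSideAt (h : IsSeparation L U V) (he : IsFlatChart L x e) : IsSideAt L U x := by
  have hupper : e (0, 1) ∉ L := mt he.apply_mem_iff.1 one_ne_zero
  rcases h.mem_or_mem hupper with hU | hV
  · exact ⟨e, he, (h.preimage_eq_of_apply_mem he one_pos hU).1⟩
  · refine ⟨_, he.comp_reflection, ?_⟩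
    rw [preimage_comp, (h.symm.preimage_eq_of_apply_mem he one_pos hV).2]
    ext p
    simp

theorem eventuallyEq_of_mem_nhdsWithin (h : IsSeparation L U V) (hW : IsSideAt L W x)
    (hU : U ∈ 𝓝[W] x) : U =ᶠ[𝓝 x] W := by
  have := hW.nhdsWithin_neBot
  obtain ⟨e, he, heW⟩ := hW
  obtain ⟨_, hpU, hpW, p, rfl⟩ := Filter.nonempty_of_mem
    (inter_mem hU (inter_mem self_mem_nhdsWithin (mem_nhdsWithin_of_mem_nhds he.range_mem_nhds)))
  have heU := (h.preimage_eq_of_apply_mem he (heW.subset hpW) hpU).1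
  filter_upwards [he.range_mem_nhds]
  rintro _ ⟨q, rfl⟩
  exact congrArg (q ∈ ·) (heU.trans heW.symm)

end IsSeparation

theorem nonempty_inter_closure_of_isPreconnected {C L u v : Set F} (hC : IsPreconnected C)
    (hL : IsClosed L) (hu : IsOpen u) (hv : IsOpen v) (hcover : C \ L ⊆ u ∪ v)
    (hdisj : (C \ L) ∩ (u ∩ v) = ∅) (hCu : ((C \ L) ∩ u).Nonempty)
    (hCv : ((C \ L) ∩ v).Nonempty) : (L ∩ closure ((C \ L) ∩ u)).Nonempty := by
  by_contra hne
  have hL_closure {x : F} (hx : x ∈ closure ((C \ L) ∩ u)) : x ∉ L := fun hxL => hne ⟨x, hxL, hx⟩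
  obtain ⟨x, hx, ⟨hxu, hxL⟩, hxv⟩ := hC (u \ L) (v ∪ (closure ((C \ L) ∩ u))ᶜ) (hu.sdiff hL)
    (hv.union isClosed_closure.isOpen_compl)
    (fun x hx => by
      by_cases hxu : x ∈ closure ((C \ L) ∩ u)
      · exact (hcover ⟨hx, hL_closure hxu⟩).imp (⟨·, hL_closure hxu⟩) Or.inl
      · exact Or.inr (Or.inr hxu))
    (hCu.mono fun x hx => ⟨hx.1.1, hx.2, hx.1.2⟩)
    (hCv.mono fun x hx => ⟨hx.1.1, Or.inl hx.2⟩)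
  rcases hxv with hxv | hxv
  · exact hdisj.subset ⟨⟨hx, hxL⟩, hxu, hxv⟩
  · exact hxv (subset_closure ⟨⟨hx, hxL⟩, hxu⟩)

theorem isSplitting_of_connectedComponent {x : F} {L u v : Set F}
    (hL : L ⊆ connectedComponent x) (hu : IsOpen u) (hv : IsOpen v)
    (hcover : connectedComponent x \ L ⊆ u ∪ v)
    (hdisj : (connectedComponent x \ L) ∩ (u ∩ v) = ∅) :
    IsSplitting L ((connectedComponent x \ L) ∩ u)
      ((connectedComponent x \ L) ∩ v ∪ (connectedComponent x)ᶜ) := by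
  set C := connectedComponent x
  refine ⟨?_, ?_, fun A hA hAL => ?_⟩
  · rw [Set.disjoint_left]
    rintro y ⟨hy, hyu⟩ (⟨-, hyv⟩ | hyC)
    exacts [hdisj.subset ⟨hy, hyu, hyv⟩, hyC hy.1]
  · rw [← union_assoc, ← inter_union_distrib_left, inter_eq_left.2 hcover]
    ext y
    by_cases hyC : y ∈ C
    · simp [hyC]
    · simp [hyC, mt (@hL y) hyC]
  · by_cases hAC : (A ∩ C).Nonempty
    · obtain ⟨a, haA, haC⟩ := hAC
      have hsub : A ⊆ C \ L := subset_sdiff.2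
        ⟨(hA.subset_connectedComponent haA).trans (connectedComponent_eq haC).ge, hAL⟩
      have hempty : A ∩ (u ∩ v) = ∅ :=
        subset_eq_empty (inter_subset_inter_left _ hsub) hdisj
      exact (isPreconnected_iff_subset_of_disjoint.1 hA u v hu hv (hsub.trans hcover) hempty).imp
        (subset_inter hsub) fun hAv => (subset_inter hsub hAv).trans subset_union_left
    · exact Or.inr fun a haA => Or.inr fun haC => hAC ⟨a, haA, haC⟩

theorem exists_isSeparation {L : Set F} (hL : IsLocallyFlat L) (hLp : IsPreconnected L)
    (hLc : IsClosed L) (h : ¬ IsNonSeparating L) : ∃ U V, IsSeparation L U V := by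
  simp only [IsNonSeparating, not_forall] at h
  obtain ⟨x, hx, hconn⟩ := h
  set C := connectedComponent x
  have hLC : L ⊆ C := hLp.subset_connectedComponent hx
  have hne : (C \ L).Nonempty := by
    obtain ⟨e, he⟩ := hL x hx
    exact ⟨e (0, 1), (isPreconnected_range he.1.continuous).subset_connectedComponent
      ⟨(0, 0), he.2.1⟩ (mem_range_self _), mt he.apply_mem_iff.1 one_ne_zero⟩
  have hpre : ¬ IsPreconnected (C \ L) := fun hpre => hconn ⟨hne, hpre⟩
  simp only [IsPreconnected, not_forall, not_nonempty_iff_eq_empty] at hpre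
  obtain ⟨u, v, hu, hv, hcover, hCu, hCv, hdisj⟩ := hpre
  have hsplit := isSplitting_of_connectedComponent hLC hu hv hcover hdisj
  have hC : IsPreconnected C := isPreconnected_connectedComponent
  refine ⟨_, _, hsplit, hsplit.subset_closure_left hL hLp ?_,
    hsplit.symm.subset_closure_left hL hLp ?_⟩
  · exact nonempty_inter_closure_of_isPreconnected hC hLc hu hv hcover hdisj hCu hCv
  · exact (nonempty_inter_closure_of_isPreconnected hC hLc hv hu (union_comm u v ▸ hcover)
      (inter_comm u v ▸ hdisj) hCv hCu).mono (by gcongr; exact subset_union_left)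

end Sides

section Circle

variable {P : Finset UnitAddCircle} {p p' q r : UnitAddCircle}

/-- The length of the arc from `p` forwards to `q`, the whole circle if `p = q`. -/
noncomputable def arcLength (p q : UnitAddCircle) : ℝ := AddCircle.equivIoc (1 : ℝ) 0 (q - p)

theorem arcLength_pos (p q : UnitAddCircle) : 0 < arcLength p q :=
  (AddCircle.equivIoc (1 : ℝ) 0 (q - p)).2.1

theorem arcLength_le_one (p q : UnitAddCircle) : arcLength p q ≤ 1 :=
  (AddCircle.equivIoc (1 : ℝ) 0 (q - p)).2.2.trans_eq (zero_add 1)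

theorem coe_arcLength (p q : UnitAddCircle) : (arcLength p q : UnitAddCircle) = q - p :=
  AddCircle.coe_equivIoc

theorem add_arcLength (p q : UnitAddCircle) : p + (arcLength p q : UnitAddCircle) = q := by
  rw [coe_arcLength, add_sub_cancel]

theorem arcLength_add {d : ℝ} (hd_pos : 0 < d) (hd : d ≤ 1) (p : UnitAddCircle) :
    arcLength p (p + (d : UnitAddCircle)) = d := by
  rw [arcLength, add_sub_cancel_left, AddCircle.equivIoc_coe_eq ⟨hd_pos, by simpa using hd⟩]

theorem arcLength_eq_sub (h : arcLength p r < arcLength p q) :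
    arcLength r q = arcLength p q - arcLength p r := by
  have hq : r + ((arcLength p q - arcLength p r : ℝ) : UnitAddCircle) = q := by
    rw [AddCircle.coe_sub, coe_arcLength, coe_arcLength, sub_sub_sub_cancel_right, add_sub_cancel]
  conv_lhs => rw [← hq]
  exact arcLength_add (sub_pos.2 h)
    ((sub_le_self _ (arcLength_pos p r).le).trans (arcLength_le_one p q)) r

theorem arcLength_lt (h : arcLength p q < arcLength p' q) : arcLength p' p < arcLength p' q := by
  have hp : p' + ((arcLength p' q - arcLength p q : ℝ) : UnitAddCircle) = p := by
    rw [AddCircle.coe_sub, coe_arcLength, coe_arcLength, sub_sub_sub_cancel_left, add_sub_cancel]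
  have hlt : arcLength p' q - arcLength p q < arcLength p' q := sub_lt_self _ (arcLength_pos p q)
  conv_lhs => rw [← hp]
  rwa [arcLength_add (sub_pos.2 h) (hlt.le.trans (arcLength_le_one p' q))]

/-- Going forwards from the point `p` of `P`, the point `q` is the first one of `P` met. It is `p`
itself if `P` has no other point. -/
def IsNext (P : Finset UnitAddCircle) (p q : UnitAddCircle) : Prop :=
  p ∈ P ∧ q ∈ P ∧ ∀ r ∈ P, arcLength p q ≤ arcLength p r

theorem exists_isNext (hp : p ∈ P) : ∃ q, IsNext P p q := by
  obtain ⟨q, hq, hmin⟩ := P.exists_min_image (arcLength p) ⟨p, hp⟩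
  exact ⟨q, hp, hq, hmin⟩

theorem IsNext.add_notMem (h : IsNext P p q) {d : ℝ} (hd_pos : 0 < d) (hd : d < arcLength p q) :
    p + (d : UnitAddCircle) ∉ P := fun hmem =>
  hd.not_ge ((h.2.2 _ hmem).trans_eq
    (arcLength_add hd_pos (hd.le.trans (arcLength_le_one p q)) p))

theorem IsNext.left_unique (h : IsNext P p q) (h' : IsNext P p' q) : p = p' := by
  have hle {a b : UnitAddCircle} (ha : IsNext P a q) (hb : IsNext P b q) :
      arcLength a q ≤ arcLength b q :=
    not_lt.1 fun hlt => (arcLength_lt hlt).not_ge (ha.2.2 _ hb.1)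
  have hq := (add_arcLength p q).trans (add_arcLength p' q).symm
  rw [(hle h h').antisymm (hle h' h)] at hq
  exact add_right_cancel hq

theorem eq_of_isNext {α : Type*} {g : UnitAddCircle → α} (hg : ∀ p q, IsNext P p q → g p = g q)
    (hp : p ∈ P) (hq : q ∈ P) : g p = g q := by
  classical
  by_contra hne
  -- A shortest arc between points of `P` with different values has no point of `P` inside.
  obtain ⟨⟨a, b⟩, hab, hmin⟩ := ((P ×ˢ P).filter fun x => g x.1 ≠ g x.2).exists_min_image
    (fun x => arcLength x.1 x.2) ⟨(p, q), by simp [hp, hq, hne]⟩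
  simp only [Finset.mem_filter, Finset.mem_product, and_imp, Prod.forall] at hab hmin
  obtain ⟨⟨ha, hb⟩, hgab⟩ := hab
  refine hgab (hg a b ⟨ha, hb, fun r hr => ?_⟩)
  by_contra! hlt
  by_cases hgr : g a = g r
  · refine (hmin r b hr hb (hgr ▸ hgab)).not_gt ?_
    rw [arcLength_eq_sub hlt]
    exact sub_lt_self _ (arcLength_pos a r)
  · exact (hmin a r ha hr hgr).not_gt hlt

theorem sum_eq_zero_of_isNext {g : UnitAddCircle → ℤ} (hg : ∀ p q, IsNext P p q → g p = -g q) :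
    ∑ t ∈ P, g t = 0 := by
  choose! next hnext using fun p => exists_isNext (P := P) (p := p)
  have hmaps : MapsTo next P P := fun p hp => (hnext p hp).2.1
  have hinj : InjOn next P := fun p hp p' hp' h =>
    (hnext p hp).left_unique (h ▸ hnext p' hp')
  refine self_eq_neg.1 ?_
  calc ∑ t ∈ P, g t = ∑ t ∈ P, -g t := Finset.sum_nbij next hmaps hinj
        (Finset.surjOn_of_injOn_of_card_le next hmaps hinj le_rfl)
        fun p hp => hg p _ (hnext p hp)
    _ = -∑ t ∈ P, g t := Finset.sum_neg_distrib g

end Circle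

/-- The contribution of a pole of the given kind to the balance of sinks against sources. -/
def PoleKind.sign : PoleKind → ℤ
  | PoleKind.sink => 1
  | PoleKind.source => -1

theorem PoleKind.sign_eq_neg_sign {κ κ' : PoleKind} (h : κ ≠ κ') : κ.sign = -κ'.sign := by
  cases κ <;> cases κ' <;> simp_all [sign]

theorem PoleKind.sign_ne_zero (κ : PoleKind) : κ.sign ≠ 0 := by
  cases κ <;> simp [sign]

namespace PoleCurve

variable {F : Type*} [TopologicalSpace F] {l l' : PoleCurve F} {U V : Set F}
  {p q t : UnitAddCircle}

theorem isCompact_carrier (l : PoleCurve F) : IsCompact l.carrier :=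
  isCompact_range l.continuous_toFun

theorem isPreconnected_carrier (l : PoleCurve F) : IsPreconnected l.carrier :=
  isPreconnected_range l.continuous_toFun

theorem dir_add_eq_of_notMem_poles (l : PoleCurve F) {d : ℝ}
    (hd : ∀ r ∈ Ioo 0 d, p + (r : UnitAddCircle) ∉ l.poles) {r r' : ℝ} (hr : r ∈ Ioo 0 d)
    (hr' : r' ∈ Ioo 0 d) :
    l.dir (p + (r : UnitAddCircle)) = l.dir (p + (r' : UnitAddCircle)) := by
  refine isPreconnected_Ioo.constant (f := fun r : ℝ => l.dir (p + (r : UnitAddCircle)))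
    (fun u hu => ContinuousAt.continuousWithinAt (EventuallyEq.continuousAt
      (y := l.dir (p + (u : UnitAddCircle))) ?_)) hr hr'
  have hlim : Tendsto (fun v : ℝ => v - u) (𝓝 u) (𝓝 0) :=
    tendsto_sub_nhds_zero_iff.2 tendsto_id
  filter_upwards [hlim.eventually (l.dir_of_notMem _ (hd u hu))] with v hv
  rw [← hv, add_assoc, ← AddCircle.coe_add, add_sub_cancel]

theorem eventually_dir_iff (ht : t ∈ l.poles) : ∀ᶠ ε : ℝ in 𝓝[>] 0,
    (l.dir (t - (ε : UnitAddCircle)) = true ↔ l.kind t = PoleKind.sink) ∧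
      (l.dir (t + (ε : UnitAddCircle)) = true ↔ l.kind t = PoleKind.source) := by
  cases hk : l.kind t
  · filter_upwards [l.dir_of_sink t ht hk] with ε hε using by simp [hε]
  · filter_upwards [l.dir_of_source t ht hk] with ε hε using by simp [hε]

theorem kind_ne_of_isNext (h : IsNext l.poles p q) : l.kind p ≠ l.kind q := by
  set d := arcLength p q
  obtain ⟨ε, ⟨⟨-, hp⟩, hq, -⟩, hε_pos, hε⟩ := ((eventually_dir_iff h.1).and
    (eventually_dir_iff h.2.1)).and (Ioo_mem_nhdsGT (arcLength_pos p q)) |>.exists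
  have hback : q - (ε : UnitAddCircle) = p + ((d - ε : ℝ) : UnitAddCircle) := by
    rw [AddCircle.coe_sub, ← add_sub_assoc, add_arcLength]
  have hdir := l.dir_add_eq_of_notMem_poles (fun r hr => h.add_notMem hr.1 hr.2) ⟨hε_pos, hε⟩
    (⟨sub_pos.2 hε, sub_lt_self d hε_pos⟩ : d - ε ∈ Ioo 0 d)
  rw [← hback, Bool.eq_iff_iff, hp, hq] at hdir
  cases hkp : l.kind p <;> cases hkq : l.kind q <;> simp_all

theorem sum_sign_eq_zero (l : PoleCurve F) : ∑ t ∈ l.poles, (l.kind t).sign = 0 :=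
  sum_eq_zero_of_isNext fun _ _ h => PoleKind.sign_eq_neg_sign (kind_ne_of_isNext h)

/-- The pole at `t` faces `U`: near the pole, its side of the curve is contained in `U`. -/
def PoleOn (l : PoleCurve F) (U : Set F) (t : UnitAddCircle) : Prop :=
  U ∈ 𝓝[l.side t] (l.toFun t)

open Classical in
/-- The number of sinks facing `U` minus the number of sources facing `U`. -/
noncomputable def excess (l : PoleCurve F) (U : Set F) : ℤ :=
  ∑ t ∈ l.poles, if l.PoleOn U t then (l.kind t).sign else 0

theorem poleOn_or_poleOn (h : IsSplitting l.carrier U V) (ht : t ∈ l.poles) :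
    l.PoleOn U t ∨ l.PoleOn V t :=
  h.mem_nhdsWithin_or (l.isSideAt_side t ht)

theorem PoleOn.not_poleOn (h : IsSplitting l.carrier U V) (ht : t ∈ l.poles)
    (hU : l.PoleOn U t) : ¬ l.PoleOn V t :=
  have := (l.isSideAt_side t ht).nhdsWithin_neBot
  h.notMem_nhdsWithin_of_mem hU

theorem poleOn_iff_of_eventually {W : Set F}
    (hW : ∀ᶠ y in 𝓝 (l.toFun t), y ∈ W ↔ y ∈ l.side t) :
    l.PoleOn U t ↔ U ∈ 𝓝[W] (l.toFun t) := by
  rw [PoleOn, nhdsWithin_eq_iff_eventuallyEq.2 (eventuallyEq_set.2 hW)]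

theorem IsReduciblePair.poleOn (hpq : l.IsReduciblePair p q) (h : IsSplitting l.carrier U V)
    (hp : l.PoleOn U p) : l.PoleOn U q := by
  obtain ⟨-, -, -, d, hd, -, rfl, -, W, hW, hWp, hWq⟩ := hpq
  rw [poleOn_iff_of_eventually hWp] at hp
  rw [poleOn_iff_of_eventually hWq]
  set g : ℝ → F := fun r => l.toFun (p + (r : UnitAddCircle))
  have hg : Continuous g := l.continuous_toFun.comp
    (continuous_const.add (AddCircle.continuous_mk' (1 : ℝ)))
  have hg_zero : g 0 = l.toFun p := by simp [g]
  have hopen (A : Set F) : IsOpen {r | A ∈ 𝓝[W] (g r)} := by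
    simp only [mem_nhdsWithin_iff_eventually]
    exact isOpen_setOfPred_eventually_nhds.preimage hg
  have hdisj {r : ℝ} (hr : r ∈ Icc 0 d) (hU : U ∈ 𝓝[W] (g r)) : V ∉ 𝓝[W] (g r) :=
    have := (hW r hr.1 hr.2).nhdsWithin_neBot
    h.notMem_nhdsWithin_of_mem hU
  have hzero : (0 : ℝ) ∈ Icc 0 d := left_mem_Icc.2 hd.le
  rcases isPreconnected_iff_subset_of_disjoint.1 isPreconnected_Icc _ _ (hopen U) (hopen V)
    (fun r hr => h.mem_nhdsWithin_or (hW r hr.1 hr.2))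
    (eq_empty_of_forall_notMem fun r ⟨hr, hU, hV⟩ => hdisj hr hU hV) with hU | hV
  · exact hU (right_mem_Icc.2 hd.le)
  · exact absurd (hV hzero) (hdisj hzero (hg_zero ▸ hp))

theorem IsReduciblePair.poleOn_iff (hpq : l.IsReduciblePair p q)
    (h : IsSplitting l.carrier U V) : l.PoleOn U p ↔ l.PoleOn U q :=
  ⟨hpq.poleOn h, fun hq => (poleOn_or_poleOn h hpq.1).resolve_right fun hp =>
    hq.not_poleOn h hpq.2.1 (hpq.poleOn h.symm hp)⟩

theorem Reduces.toFun_eq (hl : l.Reduces l') : l'.toFun = l.toFun := by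
  obtain ⟨_, _, -, h, -⟩ := hl
  exact h

theorem Reduces.excess_eq (hl : l.Reduces l') (h : IsSplitting l.carrier U V) :
    l'.excess U = l.excess U := by
  classical
  obtain ⟨p, q, hpq, hfun, hpoles, hside⟩ := hl
  have hkind : l.kind p ≠ l.kind q := hpq.2.2.1
  have hq : q ∈ l.poles.erase p := Finset.mem_erase.2 ⟨fun h => hkind (h ▸ rfl), hpq.2.1⟩
  have hpoles_eq : l'.poles = (l.poles.erase p).erase q := by
    ext t
    rw [hpoles, Finset.mem_erase, Finset.mem_erase]
    tauto
  have hterm : ∀ t ∈ l'.poles, (if l'.PoleOn U t then (l'.kind t).sign else 0) =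
      if l.PoleOn U t then (l.kind t).sign else 0 := fun t ht => by
    rw [(hside t ht).1, poleOn_iff_of_eventually (hside t ht).2, PoleOn, hfun]
  have hcancel : (if l.PoleOn U p then (l.kind p).sign else 0) +
      (if l.PoleOn U q then (l.kind q).sign else 0) = 0 := by
    rw [PoleKind.sign_eq_neg_sign hkind]
    simp only [hpq.poleOn_iff h]
    split_ifs <;> simp
  rw [excess, Finset.sum_congr rfl hterm, hpoles_eq, excess, ← Finset.add_sum_erase _ _ hpq.1,
    ← Finset.add_sum_erase _ _ hq, ← add_assoc, hcancel, zero_add]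

theorem toFun_eq_and_excess_eq_of_reflTransGen (hl : Relation.ReflTransGen Reduces l l')
    (h : IsSplitting l.carrier U V) : l'.toFun = l.toFun ∧ l'.excess U = l.excess U := by
  induction hl with
  | refl => exact ⟨rfl, rfl⟩
  | tail _ hred ih =>
    refine ⟨hred.toFun_eq.trans ih.1, (hred.excess_eq (V := V) ?_).trans ih.2⟩
    rwa [carrier, ih.1]

theorem IsIrreducible.not_poleOn_of_isNext (hl : l.IsIrreducible)
    (hflat : IsLocallyFlat l.carrier) (h : IsSeparation l.carrier U V)
    (hpq : IsNext l.poles p q) (hp : l.PoleOn U p) : ¬ l.PoleOn U q := by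
  have hkind := kind_ne_of_isNext hpq
  have hlt : arcLength p q < 1 := (arcLength_le_one p q).lt_of_ne fun h => hkind <| by
    rw [← add_arcLength p q, h, AddCircle.coe_period, add_zero]
  have hside {t : UnitAddCircle} (ht : t ∈ l.poles) (hU : l.PoleOn U t) :
      ∀ᶠ y in 𝓝 (l.toFun t), y ∈ U ↔ y ∈ l.side t :=
    (h.eventuallyEq_of_mem_nhdsWithin (l.isSideAt_side t ht) hU).mem_iff
  refine fun hq => hl p q ⟨hpq.1, hpq.2.1, hkind, arcLength p q, arcLength_pos p q, hlt,
    (add_arcLength p q).symm, fun r => hpq.add_notMem, U, fun r _ _ => ?_, hside hpq.1 hp,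
    hside hpq.2.1 hq⟩
  obtain ⟨e, he⟩ := hflat _ (mem_range_self (p + (r : UnitAddCircle)))
  exact h.isSideAt he

theorem IsIrreducible.poleOn_iff_not_of_isNext (hl : l.IsIrreducible)
    (hflat : IsLocallyFlat l.carrier) (h : IsSeparation l.carrier U V)
    (hpq : IsNext l.poles p q) : l.PoleOn U p ↔ ¬ l.PoleOn U q := by
  refine ⟨hl.not_poleOn_of_isNext hflat h hpq, fun hq => ?_⟩
  have hqV := (poleOn_or_poleOn h.toIsSplitting hpq.2.1).resolve_left hq
  exact (poleOn_or_poleOn h.toIsSplitting hpq.1).resolve_right fun hpV =>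
    hl.not_poleOn_of_isNext hflat h.symm hpq hpV hqV

theorem IsIrreducible.poles_eq_empty (hl : l.IsIrreducible) (hflat : IsLocallyFlat l.carrier)
    (h : IsSeparation l.carrier U V) (hex : l.excess U = 0) : l.poles = ∅ := by
  classical
  set w : UnitAddCircle → ℤ := fun t => if l.PoleOn U t then (l.kind t).sign else -(l.kind t).sign
  have hw_next (p q) (hpq : IsNext l.poles p q) : w p = w q := by
    simp only [w, hl.poleOn_iff_not_of_isNext hflat h hpq,
      PoleKind.sign_eq_neg_sign (kind_ne_of_isNext hpq)]
    split_ifs <;> simp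
  have hw_sum : ∑ t ∈ l.poles, w t = 0 := calc
    ∑ t ∈ l.poles, w t = 2 * l.excess U - ∑ t ∈ l.poles, (l.kind t).sign := by
      rw [excess, Finset.mul_sum, ← Finset.sum_sub_distrib]
      refine Finset.sum_congr rfl fun t _ => ?_
      simp only [w]
      split_ifs <;> ring
    _ = 0 := by rw [hex, l.sum_sign_eq_zero, mul_zero, sub_zero]
  refine Finset.eq_empty_of_forall_notMem fun p hp => ?_
  have hw_ne : w p ≠ 0 := by
    simp only [w]
    split_ifs <;> simp [PoleKind.sign_ne_zero]
  rw [Finset.sum_congr rfl fun t ht => eq_of_isNext hw_next ht hp, Finset.sum_const,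
    smul_eq_zero, Finset.card_eq_zero] at hw_sum
  exact Finset.ne_empty_of_mem hp (hw_sum.resolve_right hw_ne)

theorem HasIndex.eq_zero {k : ℕ} (hk : l.HasIndex k) (hflat : IsLocallyFlat l.carrier)
    (h : IsSeparation l.carrier U V) (hex : l.excess U = 0) : k = 0 := by
  obtain ⟨l', hred, hirr, hcard⟩ := hk
  obtain ⟨hfun, hex'⟩ := toFun_eq_and_excess_eq_of_reflTransGen hred h.toIsSplitting
  have hcarrier : l'.carrier = l.carrier := congrArg range hfun
  rw [hirr.poles_eq_empty (hcarrier ▸ hflat) (hcarrier ▸ h) (hex'.trans hex)] at hcard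
  simpa using hcard

end PoleCurve

section Splice

/-- The homeomorphism of the plane carrying the graph of `f` to the horizontal axis. -/
def graphFlattening (f : ℝ → ℝ) (hf : Continuous f) : ℝ × ℝ ≃ₜ ℝ × ℝ where
  toFun p := (p.1, p.2 - f p.1)
  invFun p := (p.1, p.2 + f p.1)
  left_inv p := by simp
  right_inv p := by simp

theorem isLocallyFlat_horizontalAxis : IsLocallyFlat {p : ℝ × ℝ | p.2 = 0} := by
  rintro ⟨a, b⟩ rfl
  exact ⟨Homeomorph.addRight (a, 0), (Homeomorph.addRight (a, 0)).isOpenEmbedding, by simp,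
    by ext; simp⟩

theorem isLocallyFlat_graph {f : ℝ → ℝ} (hf : Continuous f) :
    IsLocallyFlat {p : ℝ × ℝ | p.2 = f p.1} := by
  convert isLocallyFlat_horizontalAxis.preimage_homeomorph (graphFlattening f hf) using 1
  ext p
  exact sub_eq_zero.symm

theorem isLocallyFlat_abs_eq {f : ℝ → ℝ} (hf : Continuous f) (hf_pos : ∀ u, 0 < f u) :
    IsLocallyFlat {p : ℝ × ℝ | |p.2| = f p.1} := by
  intro p hp
  have hp : |p.2| = f p.1 := hp
  rcases lt_or_gt_of_ne (abs_pos.1 (hp ▸ hf_pos p.1)) with hneg | hpos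
  · rw [abs_of_neg hneg, neg_eq_iff_eq_neg] at hp
    obtain ⟨e, he⟩ := isLocallyFlat_graph hf.neg p hp
    refine he.exists_of_eventuallyEq (eventuallyEq_set.2 ?_)
    filter_upwards [continuous_snd.continuousAt.eventually_lt_const hneg] with q hq
    simp [abs_of_neg hq, neg_eq_iff_eq_neg]
  · rw [abs_of_pos hpos] at hp
    obtain ⟨e, he⟩ := isLocallyFlat_graph hf p hp
    refine he.exists_of_eventuallyEq (eventuallyEq_set.2 ?_)
    filter_upwards [continuous_snd.continuousAt.eventually_const_lt hpos] with q hq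
    simp [abs_of_pos hq]

/-- The coordinates `(x + y, x - y)`, in which a splice takes place in the square `[-1, 1]²`. -/
noncomputable def diagonalCoords : ℝ × ℝ ≃ₜ ℝ × ℝ where
  toFun p := (p.1 + p.2, p.1 - p.2)
  invFun p := ((p.1 + p.2) / 2, (p.1 - p.2) / 2)
  left_inv p := by ext <;> simp
  right_inv p := by ext <;> simp <;> ring

theorem isLocallyFlat_orientedArcs : IsLocallyFlat orientedArcs :=
  (isLocallyFlat_abs_eq (f := fun u => max |u| 1) (by fun_prop)
    fun _ => lt_max_of_lt_right one_pos).preimage_homeomorph diagonalCoords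

theorem isLocallyFlat_unorientedArcs : IsLocallyFlat unorientedArcs :=
  (isLocallyFlat_abs_eq (f := fun u => max |u| 1) (by fun_prop)
    fun _ => lt_max_of_lt_right one_pos).preimage_homeomorph
      (diagonalCoords.trans (Homeomorph.prodComm ℝ ℝ))

theorem isCompact_spliceSquare : IsCompact spliceSquare := by
  have hsquare : spliceSquare = diagonalCoords ⁻¹' (Icc (-1) 1 ×ˢ Icc (-1) 1) := by
    simp only [spliceSquare, abs_le]
    rfl
  rw [hsquare, diagonalCoords.isCompact_preimage]
  exact isCompact_Icc.prod isCompact_Icc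

theorem abs_eq_max_iff_of_lt {a b : ℝ} (h : 1 < max |a| |b|) : |a| = max |b| 1 ↔ |a| = |b| := by
  grind

theorem abs_sub_eq_abs_add_iff {x y : ℝ} : |x - y| = |x + y| ↔ x = 0 ∨ y = 0 := by
  rw [← sq_eq_sq_iff_abs_eq_abs, ← mul_eq_zero]
  constructor <;> intro h <;> linarith

theorem mem_orientedArcs_iff_of_notMem {p : ℝ × ℝ} (hp : p ∉ spliceSquare) :
    p ∈ orientedArcs ↔ p.1 = 0 ∨ p.2 = 0 := by
  have hp : 1 < max |p.1 - p.2| |p.1 + p.2| := by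
    simpa only [spliceSquare, mem_ofPred_eq, ← max_le_iff, not_le, max_comm] using hp
  exact (abs_eq_max_iff_of_lt hp).trans abs_sub_eq_abs_add_iff

theorem mem_unorientedArcs_iff_of_notMem {p : ℝ × ℝ} (hp : p ∉ spliceSquare) :
    p ∈ unorientedArcs ↔ p.1 = 0 ∨ p.2 = 0 := by
  have hp : 1 < max |p.1 + p.2| |p.1 - p.2| := by
    simpa only [spliceSquare, mem_ofPred_eq, ← max_le_iff, not_le] using hp
  exact (abs_eq_max_iff_of_lt hp).trans (eq_comm.trans abs_sub_eq_abs_add_iff)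

theorem isPreconnected_middleRegion : IsPreconnected middleRegion := by
  have hstar : StarConvex ℝ (0 : ℝ × ℝ) middleRegion := by
    rw [starConvex_zero_iff]
    intro p hp r hr_nonneg hr_le
    have hp : |p.1 + p.2| < max |p.1 - p.2| 1 := hp
    change |r * p.1 + r * p.2| < max |r * p.1 - r * p.2| 1
    rw [← mul_add, ← mul_sub, abs_mul, abs_mul, abs_of_nonneg hr_nonneg]
    rcases hr_nonneg.eq_or_lt with rfl | hr_pos
    · simp
    calc r * |p.1 + p.2| < r * max |p.1 - p.2| 1 := mul_lt_mul_of_pos_left hp hr_pos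
      _ = max (r * |p.1 - p.2|) (r * 1) := mul_max_of_nonneg _ _ hr_nonneg
      _ ≤ max (r * |p.1 - p.2|) 1 := max_le_max_left _ (by rwa [mul_one])
  exact (hstar.isPathConnected (by simp [middleRegion])).isConnected.isPreconnected

theorem mem_closure_middleRegion {a : ℝ} (ha : |a| = 1 / 2) : (a, a) ∈ closure middleRegion := by
  have hcont : Continuous fun r : ℝ => (r * a, r * a) := by fun_prop
  have hlim : Tendsto (fun r : ℝ => (r * a, r * a)) (𝓝[<] 1) (𝓝 (a, a)) :=
    (hcont.tendsto' 1 (a, a) (by simp)).mono_left nhdsWithin_le_nhds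
  refine mem_closure_of_tendsto hlim ?_
  filter_upwards [Ioo_mem_nhdsLT (zero_lt_one (α := ℝ))] with r hr
  change |r * a + r * a| < max |r * a - r * a| 1
  refine lt_max_of_lt_right ?_
  rw [← two_mul, abs_mul, abs_mul, ha, abs_two, abs_of_pos hr.1]
  linarith [hr.2]

theorem disjoint_middleRegion_unorientedArcs : Disjoint middleRegion unorientedArcs :=
  Set.disjoint_left.2 fun _ hp hp' => (ne_of_lt hp) hp'

end Splice

theorem PoleCurveLink.injective_toFun {F : Type*} [TopologicalSpace F] (s : PoleCurveLink F) :
    Function.Injective fun x : Σ _ : Fin s.n, UnitAddCircle => (s.curve x.1).toFun x.2 := by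
  rintro ⟨i, t⟩ ⟨j, u⟩ (h : (s.curve i).toFun t = (s.curve j).toFun u)
  obtain rfl : i = j := by
    by_contra hij
    exact Set.disjoint_left.1 (s.disjoint i j hij) (mem_range_self t) (h ▸ mem_range_self u)
  rw [(s.curve i).injective_toFun h]

namespace LinkDiagram

variable {F : Type*} [TopologicalSpace F] (D : LinkDiagram F) {σ : Fin D.m → Splice}

theorem eq_of_chart_eq {c c' : Fin D.m} {p q : ℝ × ℝ} (h : D.chart c p = D.chart c' q) :
    c = c' ∧ p = q := by
  obtain rfl : c = c' := by
    by_contra hc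
    exact Set.disjoint_left.1 (D.disjoint_chart c c' hc) (mem_range_self p) (h ▸ mem_range_self q)
  exact ⟨rfl, (D.isOpenEmbedding_chart c).injective h⟩

theorem chart_mem_splicedCarrier_iff {c : Fin D.m} {p : ℝ × ℝ} :
    D.chart c p ∈ D.splicedCarrier σ ↔ p ∈ D.spliceArcs c (σ c) := by
  refine ⟨?_, fun h => Or.inr (mem_iUnion.2 ⟨c, mem_image_of_mem _ h⟩)⟩
  rintro (⟨-, h⟩ | h)
  · exact absurd (mem_iUnion.2 ⟨c, mem_range_self p⟩) h
  · obtain ⟨c', q, hq, h⟩ := mem_iUnion.1 h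
    obtain ⟨rfl, rfl⟩ := D.eq_of_chart_eq h
    exact hq

theorem mem_splicedCarrier_iff_of_forall_notMem_range {x : F} (hx : ∀ c, x ∉ range (D.chart c)) :
    x ∈ D.splicedCarrier σ ↔ x ∈ D.carrier := by
  have hx_image (c : Fin D.m) (A : Set (ℝ × ℝ)) : x ∉ D.chart c '' A :=
    fun h => hx c (image_subset_range _ _ h)
  simp only [splicedCarrier, mem_union, Set.mem_sdiff, mem_iUnion, hx, hx_image, exists_false,
    not_false_iff, and_true, or_false]

theorem mem_splicedCarrier_iff {x : F} (hx : ∀ c, x ∉ D.chart c '' spliceSquare) :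
    x ∈ D.splicedCarrier σ ↔ x ∈ D.carrier := by
  by_cases h : ∃ c, x ∈ range (D.chart c)
  · obtain ⟨c, p, rfl⟩ := h
    have hp : p ∉ spliceSquare := fun hp => hx c (mem_image_of_mem _ hp)
    have hcarrier : D.chart c p ∈ D.carrier ↔ p.1 = 0 ∨ p.2 = 0 :=
      Set.ext_iff.1 (D.chart_preimage c) p
    rw [chart_mem_splicedCarrier_iff, hcarrier, spliceArcs]
    split_ifs
    · exact mem_orientedArcs_iff_of_notMem hp
    · exact mem_unorientedArcs_iff_of_notMem hp
  · exact D.mem_splicedCarrier_iff_of_forall_notMem_range (not_exists.1 h)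

theorem isLocallyFlat_spliceArcs (c : Fin D.m) (a : Splice) :
    IsLocallyFlat (D.spliceArcs c a) := by
  unfold spliceArcs
  split_ifs
  · exact isLocallyFlat_orientedArcs
  · exact isLocallyFlat_unorientedArcs

theorem isLocallyFlat_splicedCarrier [T2Space F] : IsLocallyFlat (D.splicedCarrier σ) := by
  intro x hx
  by_cases h : ∃ c, x ∈ range (D.chart c)
  · obtain ⟨c, p, rfl⟩ := h
    obtain ⟨e, he⟩ := D.isLocallyFlat_spliceArcs c (σ c) p (D.chart_mem_splicedCarrier_iff.1 hx)
    exact ⟨_, he.comp_isOpenEmbedding (D.isOpenEmbedding_chart c)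
      (Set.ext fun _ => D.chart_mem_splicedCarrier_iff)⟩
  · push Not at h
    have hsquare (c) : x ∉ D.chart c '' spliceSquare := fun hc => h c (image_subset_range _ _ hc)
    obtain ⟨k, t, rfl⟩ := mem_iUnion.1 ((D.mem_splicedCarrier_iff hsquare).1 hx)
    obtain ⟨e, he⟩ := D.flat k t fun c hc => h c (hc ▸ mem_range_self _)
    have hev : ∀ᶠ y in 𝓝 (D.comp k t), ∀ c, y ∉ D.chart c '' spliceSquare :=
      eventually_all.2 fun c =>
        (isCompact_spliceSquare.image (D.isOpenEmbedding_chart c).continuous).isClosed.isOpen_compl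
          |>.mem_nhds (hsquare c)
    exact he.exists_of_eventuallyEq
      (eventuallyEq_set.2 (hev.mono fun y hy => (D.mem_splicedCarrier_iff hy).symm))

/-- The point at which a pole of the given kind is created at a crossing. -/
noncomputable def polePoint (c : Fin D.m) : PoleKind → F
  | PoleKind.sink => D.sinkPoint c
  | PoleKind.source => D.sourcePoint c

theorem exists_eq_polePoint_iff {c : Fin D.m} {x : F} :
    (∃ κ, x = D.polePoint c κ) ↔ x = D.sinkPoint c ∨ x = D.sourcePoint c :=
  ⟨by rintro ⟨_ | _, h⟩; exacts [Or.inl h, Or.inr h],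
    by rintro (h | h); exacts [⟨PoleKind.sink, h⟩, ⟨PoleKind.source, h⟩]⟩

theorem exists_polePoint_eq_chart (c : Fin D.m) (κ : PoleKind) :
    ∃ a : ℝ, |a| = 1 / 2 ∧ D.polePoint c κ = D.chart c (a, a) := by
  cases κ
  · exact ⟨-(1 / 2), by norm_num, rfl⟩
  · exact ⟨1 / 2, by norm_num, rfl⟩

theorem polePoint_mem_splicedCarrier {c : Fin D.m} (hc : ¬ D.IsOrientedSplice c (σ c))
    (κ : PoleKind) : D.polePoint c κ ∈ D.splicedCarrier σ := by
  obtain ⟨a, ha, hκ⟩ := D.exists_polePoint_eq_chart c κ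
  rw [hκ, chart_mem_splicedCarrier_iff, spliceArcs, if_neg hc]
  change |a + a| = max |a - a| 1
  rw [← two_mul, abs_mul, ha]
  norm_num

theorem polePoint_mem_closure (c : Fin D.m) (κ : PoleKind) :
    D.polePoint c κ ∈ closure (D.chart c '' middleRegion) := by
  obtain ⟨a, ha, hκ⟩ := D.exists_polePoint_eq_chart c κ
  rw [hκ]
  exact image_closure_subset_closure_image (D.isOpenEmbedding_chart c).continuous
    (mem_image_of_mem _ (mem_closure_middleRegion ha))

theorem polePoint_injective :
    Function.Injective fun x : Fin D.m × PoleKind => D.polePoint x.1 x.2 := by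
  rintro ⟨c, κ⟩ ⟨c', κ'⟩ h
  cases κ <;> cases κ' <;> obtain ⟨rfl, hp⟩ := D.eq_of_chart_eq h <;>
    first | rfl | norm_num at hp

theorem isPreconnected_image_middleRegion (c : Fin D.m) :
    IsPreconnected (D.chart c '' middleRegion) :=
  isPreconnected_middleRegion.image _ (D.isOpenEmbedding_chart c).continuous.continuousOn

theorem isPreconnected_insert_polePoint (c : Fin D.m) (κ : PoleKind) :
    IsPreconnected (insert (D.polePoint c κ) (D.chart c '' middleRegion)) :=
  (D.isPreconnected_image_middleRegion c).subset_closure (subset_insert _ _)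
    (insert_subset (D.polePoint_mem_closure c κ) subset_closure)

namespace IsSpliceOf

variable {D} {s : PoleCurveLink F} {i j : Fin s.n} {t : UnitAddCircle} {c : Fin D.m}
  {κ : PoleKind} {U V : Set F}

theorem isLocallyFlat_carrier [T2Space F] (h : D.IsSpliceOf σ s) (i : Fin s.n) :
    IsLocallyFlat (s.curve i).carrier := by
  intro x hx
  obtain ⟨e, he⟩ := D.isLocallyFlat_splicedCarrier (σ := σ) x
    (h.carrier_eq ▸ mem_iUnion.2 ⟨i, hx⟩)
  rw [← h.carrier_eq] at he
  have hev : ∀ᶠ y in 𝓝 x, ∀ j, j ≠ i → y ∉ (s.curve j).carrier := by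
    simp only [eventually_all]
    exact fun j hj => (s.curve j).isCompact_carrier.isClosed.isOpen_compl.mem_nhds
      fun hxj => Set.disjoint_left.1 (s.disjoint j i hj) hxj hx
  refine he.exists_of_eventuallyEq (eventuallyEq_set.2 (hev.mono fun y hy => ⟨fun hys => ?_,
    fun hyi => mem_iUnion.2 ⟨i, hyi⟩⟩))
  obtain ⟨j, hj⟩ := mem_iUnion.1 hys
  exact of_not_not (mt (hy j) (not_not.2 hj)) ▸ hj

theorem mem_poles_iff (h : D.IsSpliceOf σ s) : t ∈ (s.curve i).poles ↔
    ∃ c, ¬ D.IsOrientedSplice c (σ c) ∧ ∃ κ, (s.curve i).toFun t = D.polePoint c κ := by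
  simp only [h.mem_poles, exists_eq_polePoint_iff]

theorem kind_eq (h : D.IsSpliceOf σ s) (ht : t ∈ (s.curve i).poles)
    (htc : (s.curve i).toFun t = D.polePoint c κ) : (s.curve i).kind t = κ := by
  cases κ
  · exact h.sink i t ht c htc
  · exact h.source i t ht c htc

theorem nhdsWithin_side (h : D.IsSpliceOf σ s) (ht : t ∈ (s.curve i).poles)
    (htc : (s.curve i).toFun t = D.polePoint c κ) :
    𝓝[(s.curve i).side t] ((s.curve i).toFun t) =
      𝓝[D.chart c '' middleRegion] (D.polePoint c κ) := by
  rw [nhdsWithin_eq_iff_eventuallyEq.2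
    (eventuallyEq_set.2 (h.side i t ht c (D.exists_eq_polePoint_iff.1 ⟨κ, htc⟩))), htc]

theorem disjoint_image_middleRegion_carrier (h : D.IsSpliceOf σ s)
    (hc : ¬ D.IsOrientedSplice c (σ c)) (i : Fin s.n) :
    Disjoint (D.chart c '' middleRegion) (s.curve i).carrier := by
  rw [Set.disjoint_left]
  rintro _ ⟨p, hp, rfl⟩ hi
  have hmem : D.chart c p ∈ D.splicedCarrier σ := h.carrier_eq ▸ mem_iUnion.2 ⟨i, hi⟩
  rw [chart_mem_splicedCarrier_iff, spliceArcs, if_neg hc] at hmem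
  exact Set.disjoint_left.1 disjoint_middleRegion_unorientedArcs hp hmem

theorem poleOn_iff_image_middleRegion_subset (h : D.IsSpliceOf σ s)
    (hi : IsSplitting (s.curve i).carrier U V) (ht : t ∈ (s.curve j).poles)
    (hc : ¬ D.IsOrientedSplice c (σ c)) (htc : (s.curve j).toFun t = D.polePoint c κ) :
    (s.curve j).PoleOn U t ↔ D.chart c '' middleRegion ⊆ U := by
  have : (𝓝[D.chart c '' middleRegion] (D.polePoint c κ)).NeBot :=
    mem_closure_iff_nhdsWithin_neBot.1 (D.polePoint_mem_closure c κ)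
  rw [PoleCurve.PoleOn, h.nhdsWithin_side ht htc]
  refine ⟨fun hU => ?_, mem_of_superset self_mem_nhdsWithin⟩
  exact (hi.subset_or_subset _ (D.isPreconnected_image_middleRegion c)
    (h.disjoint_image_middleRegion_carrier hc i)).resolve_right fun hV =>
      hi.notMem_nhdsWithin_of_mem hU (mem_of_superset self_mem_nhdsWithin hV)

theorem exists_mem_poles_iff (h : D.IsSpliceOf σ s) {x : F} :
    (∃ i, ∃ t ∈ (s.curve i).poles, (s.curve i).toFun t = x) ↔
      ∃ c, ¬ D.IsOrientedSplice c (σ c) ∧ ∃ κ, D.polePoint c κ = x := by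
  constructor
  · rintro ⟨i, t, ht, rfl⟩
    obtain ⟨c, hc, κ, htc⟩ := h.mem_poles_iff.1 ht
    exact ⟨c, hc, κ, htc.symm⟩
  · rintro ⟨c, hc, κ, rfl⟩
    obtain ⟨i, t, htc⟩ := mem_iUnion.1 (h.carrier_eq ▸ D.polePoint_mem_splicedCarrier hc κ)
    exact ⟨i, t, h.mem_poles_iff.2 ⟨c, hc, κ, htc⟩, htc⟩

open Classical in
theorem sum_poles_eq {M : Type*} [AddCommMonoid M] (h : D.IsSpliceOf σ s) (f : F → M) :
    ∑ i, ∑ t ∈ (s.curve i).poles, f ((s.curve i).toFun t) =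
      ∑ c with ¬ D.IsOrientedSplice c (σ c),
        (f (D.polePoint c PoleKind.sink) + f (D.polePoint c PoleKind.source)) := by
  set S := Finset.univ.sigma fun i => (s.curve i).poles
  set T : Finset (Fin D.m × PoleKind) :=
    (Finset.univ.filter fun c => ¬ D.IsOrientedSplice c (σ c)) ×ˢ {PoleKind.sink, PoleKind.source}
  have himage : S.image (fun x => (s.curve x.1).toFun x.2) =
      T.image fun x => D.polePoint x.1 x.2 := by
    have hκ (κ : PoleKind) : κ = PoleKind.sink ∨ κ = PoleKind.source := by cases κ <;> simp
    ext y
    simpa [S, T, hκ, and_assoc] using h.exists_mem_poles_iff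
  calc ∑ i, ∑ t ∈ (s.curve i).poles, f ((s.curve i).toFun t)
      = ∑ y ∈ S.image fun x => (s.curve x.1).toFun x.2, f y := by
        rw [Finset.sum_image s.injective_toFun.injOn, Finset.sum_sigma]
    _ = ∑ x ∈ T, f (D.polePoint x.1 x.2) := by
        rw [himage, Finset.sum_image D.polePoint_injective.injOn]
    _ = ∑ c with ¬ D.IsOrientedSplice c (σ c),
          (f (D.polePoint c PoleKind.sink) + f (D.polePoint c PoleKind.source)) := by
        rw [Finset.sum_product]
        exact Finset.sum_congr rfl fun c _ => Finset.sum_pair (by simp)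

theorem sum_excess_eq_zero (h : D.IsSpliceOf σ s) (hi : IsSplitting (s.curve i).carrier U V) :
    ∑ j, (s.curve j).excess U = 0 := by
  classical
  set f : F → ℤ := Function.extend (fun x : Fin D.m × PoleKind => D.polePoint x.1 x.2)
    (fun x => if D.chart x.1 '' middleRegion ⊆ U then x.2.sign else 0) 0
  have hf (c : Fin D.m) (κ : PoleKind) :
      f (D.polePoint c κ) = if D.chart c '' middleRegion ⊆ U then κ.sign else 0 :=
    D.polePoint_injective.extend_apply _ _ (c, κ)
  calc ∑ j, (s.curve j).excess U
      = ∑ j, ∑ t ∈ (s.curve j).poles, f ((s.curve j).toFun t) := by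
        refine Finset.sum_congr rfl fun j _ => Finset.sum_congr rfl fun t ht => ?_
        obtain ⟨c, hc, κ, htc⟩ := h.mem_poles_iff.1 ht
        simp only [h.poleOn_iff_image_middleRegion_subset hi ht hc htc, h.kind_eq ht htc, htc, hf]
    _ = 0 := by
        rw [h.sum_poles_eq]
        refine Finset.sum_eq_zero fun c _ => ?_
        rw [hf, hf]
        split_ifs <;> simp [PoleKind.sign]

theorem poleOn_of_mem (h : D.IsSpliceOf σ s) (hi : IsSplitting (s.curve i).carrier U V)
    (ht : t ∈ (s.curve j).poles) (htU : (s.curve j).toFun t ∈ U) : (s.curve j).PoleOn U t := by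
  obtain ⟨c, hc, κ, htc⟩ := h.mem_poles_iff.1 ht
  rw [h.poleOn_iff_image_middleRegion_subset hi ht hc htc]
  rw [htc] at htU
  exact (subset_insert _ _).trans (hi.subset_left (D.isPreconnected_insert_polePoint c κ)
    (disjoint_insert_left.2 ⟨hi.notMem_of_mem_left htU, h.disjoint_image_middleRegion_carrier hc i⟩)
    (mem_insert _ _) htU)

theorem excess_eq_zero_of_ne (h : D.IsSpliceOf σ s) (hi : IsSplitting (s.curve i).carrier U V)
    (hji : j ≠ i) : (s.curve j).excess U = 0 := by
  classical
  rcases hi.subset_or_subset _ (s.curve j).isPreconnected_carrier (s.disjoint j i hji) with hU | hV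
  · rw [← (s.curve j).sum_sign_eq_zero]
    exact Finset.sum_congr rfl fun t ht => if_pos (h.poleOn_of_mem hi ht (hU (mem_range_self t)))
  · refine Finset.sum_eq_zero fun t ht => if_neg fun htU => ?_
    obtain ⟨c, hc, κ, htc⟩ := h.mem_poles_iff.1 ht
    have hMV := h.poleOn_of_mem hi.symm ht (hV (mem_range_self t))
    rw [h.poleOn_iff_image_middleRegion_subset hi ht hc htc] at htU
    rw [h.poleOn_iff_image_middleRegion_subset hi.symm ht hc htc] at hMV
    obtain ⟨y, hy⟩ := closure_nonempty_iff.1 ⟨_, D.polePoint_mem_closure c κ⟩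
    exact Set.disjoint_left.1 hi.disjoint (htU hy) (hMV hy)

theorem excess_eq_zero (h : D.IsSpliceOf σ s) (hi : IsSplitting (s.curve i).carrier U V) :
    (s.curve i).excess U = 0 := by
  rw [← h.sum_excess_eq_zero hi]
  exact (Finset.sum_eq_single i (fun j _ hji => h.excess_eq_zero_of_ne hi hji) (by simp)).symm

end IsSpliceOf

end LinkDiagram

end TwistedLink

theorem theorem2_general {F : Type*} [TopologicalSpace F] [T2Space F]
    (D : TwistedLink.LinkDiagram F) (s : TwistedLink.PoleCurveLink F)
    (hs : D.IsSurfacePoleState s) (i : Fin s.n) (k : ℕ) (hk : (s.curve i).HasIndex k)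
    (hpos : 0 < k) : TwistedLink.IsNonSeparating (s.curve i).carrier := by
  obtain ⟨σ, hσ⟩ := hs
  have hflat := hσ.isLocallyFlat_carrier i
  by_contra hsep
  obtain ⟨U, V, hUV⟩ := TwistedLink.exists_isSeparation hflat (s.curve i).isPreconnected_carrier
    (s.curve i).isCompact_carrier.isClosed hsep
  exact hpos.ne' (hk.eq_zero hflat hUV (hσ.excess_eq_zero hUV.toIsSplitting))

theorem theorem2 {F : Type*} [TopologicalSpace F] [T2Space F] [CompactSpace F]
    [ChartedSpace (EuclideanSpace ℝ (Fin 2)) F]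
    (D : TwistedLink.LinkDiagram F) (s : TwistedLink.PoleCurveLink F)
    (hs : D.IsSurfacePoleState s)
    (i : Fin s.n) (k : ℕ) (hk : (s.curve i).HasIndex k) (hpos : 0 < k) :
    TwistedLink.IsNonSeparating (s.curve i).carrier := by
  exact theorem2_general D s hs i k hk hpos
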